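/- \textbf{Setting.} Consider a network with a finite set $J$ of resources of capacities $C_j>0$ and a finite set $I$ of flow types, where a flow of type $i$ may use the resources of a nonempty set $J(i)\subseteq J$ (routes of length one). For $J'\subseteq J$ write $C(J')=\sum_{j\in J'}C_j$, $J'^c=J\setminus J'$ and $I(J')=\{i\in I: J(i)\subseteq J'\}$; for $I'\subseteq I$ write $I'^c=I\setminus I'$. Call a pair $(I',J')$ with $I'\subseteq I$ and $\emptyset\ne J'\subseteq J$ connected if $J'$ cannot be partitioned into nonempty $J_1,J_2$ such that $I'$ can be partitioned into (possibly empty) $I_1,I_2$ with $J(i)\cap J_2=\emptyset$ for $i\in I_1$ and $J(i)\cap J_1=\emptyset$ for $i\in I_2$. The set $J'$ is connected if $(I,J')$ is connected, and strongly connected if $(I(J'),J')$ is connected. Let $U:[0,\infty)\to[-\infty,\infty)$ be strictly increasing, and real-valued, strictly concave and differentiable on $(0,\infty)$. For a state $n\in[0,\infty)^I$ let $x(n)=(x_i(n))_{i\in I}$ be the rate vector that maximizes $\sum_{i}n_iU(x_i)$ subject to $x_i=\sum_{j\in J(i)}x_i^j$, $x_i^j\ge 0$ and $\sum_{i:\,j\in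 J(i)}n_ix_i^j\le C_j$ for all $j\in J$, with the convention $x_i=0$ if $n_i=0$. A state $n$ is in complete resource pooling if for all states $n'$ in some neighbourhood of $n$ in $[0,\infty)^I$ the optimal rates are $$x_i(n')=\frac{C(J)}{\sum_{k\in I}n'_k}\qquad\forall i\in I.$$ In the peak-rate-constrained elastic model with arrival rates $\lambda_i>0$, parameters $\mu_i>0$ (mean flow sizes $1/\mu_i$) and peak rates $r_i>0$, the fluid limit is $$n_i'(t)=\lambda_i-\mu_in_i(t)\min\{x_i(n(t)),r_i\},\qquad i\in I,$$ and an equilibrium point is a state $n$ at which all the right-hand sides vanish. Let $\rho_i=\lambda_i/\mu_i$, and assume the stability condition $\sum_{i\in I(J')}\rho_i<C(J')$ for all strongly connected $J'\subseteq J$. \textbf{Theorem.} Suppose that $$\sum_{i\in I(J'^c)^c}\rho_i>C(J')\qquad\text{for all connected } J'\subsetneq J.$$ Then, for all peak rates $(r_i)_{i\in I}\in(0,\infty)^I$, the fluid limit has an equilibrium point that is in complete resource pooling. (The condition does not involve the peak rates.) -/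

import Mathlib

open scoped Topology

/-- A network `(I, J, C)` with routes of length one: `C j` is the capacity of resource `j`, and
`res i` is the (nonempty) set `J(i)` of the resources that flows of type `i` can use. -/
structure Network (I J : Type*) where
  /-- capacities -/
  C : J → ℝ
  /-- the set `J(i)` -/
  res : I → Finset J
  C_pos : ∀ j, 0 < C j
  res_nonempty : ∀ i, (res i).Nonempty

/-- A utility function on `[0, ∞)`: real valued, strictly concave and differentiable on `(0, ∞)`,
and strictly increasing on `[0, ∞)`. The value at `0` may be `-∞`, as it is for the
`α`-fair utilities with `α ≥ 1`. (Values at negative arguments are never used. As `U` is increasing,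
strict concavity on `(0, ∞)` gives strict concavity on `[0, ∞)`.) -/
structure IsUtility (U : ℝ → EReal) : Prop where
  finite : ∀ x, 0 < x → U x ≠ ⊥ ∧ U x ≠ ⊤
  strictMono : StrictMonoOn U (Set.Ici 0)
  strictConcave : StrictConcaveOn ℝ (Set.Ioi 0) (fun x => (U x).toReal)
  differentiable : DifferentiableOn ℝ (fun x => (U x).toReal) (Set.Ioi 0)

namespace Network

variable {I J : Type*}

/-! ### Rate allocation -/

section Allocation

variable [Fintype I] [Fintype J]

/-- Feasibility of rates `y i j = x_i^j` (rate of each single flow of type `i` on resource `j`)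
when there are `n i` flows of type `i`. -/
structure IsFeasible (N : Network I J) (n : I → ℝ) (y : I → J → ℝ) : Prop where
  nonneg : ∀ i j, 0 ≤ y i j
  support : ∀ i j, j ∉ N.res i → y i j = 0
  capacity : ∀ j, ∑ i, n i * y i j ≤ N.C j

/-- The aggregate utility `∑ i, n_i U(x_i)` with `x_i = ∑ j, x_i^j`
(in `EReal`, where `0 * ⊥ = 0`). -/
noncomputable def utility (U : ℝ → EReal) (n : I → ℝ) (y : I → J → ℝ) : EReal :=
  ∑ i, (n i : EReal) * U (∑ j, y i j)

/-- `x` is an optimal rate vector for the state `n`: it is realised by a feasible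
allocation that maximizes the aggregate utility, with the convention `x_i = 0` if `n_i = 0`. -/
def IsRateAllocation (N : Network I J) (U : ℝ → EReal) (n : I → ℝ) (x : I → ℝ) : Prop :=
  (∃ y : I → J → ℝ, N.IsFeasible n y ∧
      (∀ y' : I → J → ℝ, N.IsFeasible n y' → utility U n y' ≤ utility U n y) ∧
      ∀ i, n i ≠ 0 → x i = ∑ j, y i j) ∧
    ∀ i, n i = 0 → x i = 0

/-- `x` is the rate vector `x(n)`, i.e. the one and only optimal rate vector for the state `n`. -/
def IsTheRateAllocation (N : Network I J) (U : ℝ → EReal) (n : I → ℝ) (x : I → ℝ) : Prop :=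
  ∀ x' : I → ℝ, N.IsRateAllocation U n x' ↔ x' = x

/-- `n` is an equilibrium point of the fluid limit
`n_i' = lam_i - mu_i n_i min {x_i(n), r_i}` of elastic traffic with peak rates `r`. -/
def IsEquilibrium (N : Network I J) (U : ℝ → EReal) (lam mu r : I → ℝ) (n : I → ℝ) : Prop :=
  (∀ i, 0 ≤ n i) ∧
    ∃ x : I → ℝ, N.IsTheRateAllocation U n x ∧ ∀ i, lam i - mu i * n i * min (x i) (r i) = 0

/-- The state `n` is in complete resource pooling: for every state `n'` in a neighbourhood of `n`
(in the nonnegative orthant), all the rates `x_i(n')` are equal to `C(J) / ∑ i, n'_i`. -/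
def IsCompleteResourcePooling (N : Network I J) (U : ℝ → EReal) (n : I → ℝ) : Prop :=
  ∀ᶠ n' in 𝓝[{v : I → ℝ | ∀ i, 0 ≤ v i}] n,
    N.IsTheRateAllocation U n' (fun _ => (∑ j, N.C j) / ∑ i, n' i)

end Allocation

/-! ### Connectivity and conditions on the traffic intensities -/

section Connectivity

variable [DecidableEq J]

/-- The pair `(I', J')` is connected: `J'` is nonempty and cannot be partitioned in nonempty
`J₁`, `J₂` such that `I'` can be partitioned in (possibly empty) `I₁`, `I₂` with
`J(i) ∩ J₂ = ∅` for `i ∈ I₁` and `J(i) ∩ J₁ = ∅` for `i ∈ I₂`. -/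
def ConnectedPair [DecidableEq I] (N : Network I J) (I' : Finset I) (J' : Finset J) : Prop :=
  J'.Nonempty ∧
    ¬ ∃ J₁ J₂ : Finset J, J₁.Nonempty ∧ J₂.Nonempty ∧ J₁ ∩ J₂ = ∅ ∧ J₁ ∪ J₂ = J' ∧
      ∃ I₁ I₂ : Finset I, I₁ ∩ I₂ = ∅ ∧ I₁ ∪ I₂ = I' ∧
        (∀ i ∈ I₁, N.res i ∩ J₂ = ∅) ∧ ∀ i ∈ I₂, N.res i ∩ J₁ = ∅

variable [Fintype I]

/-- `I(J') = {i : J(i) ⊆ J'}`, the types that have to go through `J'`. -/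
def inside (N : Network I J) (J' : Finset J) : Finset I :=
  Finset.univ.filter fun i => N.res i ⊆ J'

variable [DecidableEq I]

/-- `J'` is a connected set of resources. -/
def Connected (N : Network I J) (J' : Finset J) : Prop :=
  N.ConnectedPair Finset.univ J'

/-- `J'` is a strongly connected set of resources. -/
def StronglyConnected (N : Network I J) (J' : Finset J) : Prop :=
  N.ConnectedPair (N.inside J') J'

/-- The stability condition on the traffic intensities. -/
def Stable (N : Network I J) (rho : I → ℝ) : Prop :=
  ∀ J' : Finset J, N.StronglyConnected J' → ∑ i ∈ N.inside J', rho i < ∑ j ∈ J', N.C j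

/-- The pooling condition: `∑_{i ∈ I(J'ᶜ)ᶜ} rho_i > C(J')` for all connected `J' ≠ J`. -/
def PoolingCondition [Fintype J] (N : Network I J) (rho : I → ℝ) : Prop :=
  ∀ J' : Finset J, N.Connected J' → J' ≠ Finset.univ →
    ∑ j ∈ J', N.C j < ∑ i ∈ (N.inside J'ᶜ)ᶜ, rho i

end Connectivity

end Network

/-! If all flows receive a common rate `x`, equilibrium forces `n i = rho i / min x (r i)`, so type
`i` carries the load `n i * x = rho i * max 1 (x / r i) ≥ rho i`. The total load equals `C(J)` for
some `x > 0`: it starts below `C(J)` by stability and grows without bound, so the intermediate value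
theorem applies. As peak rates only increase loads, the pooling condition on `rho` passes to them,
whatever `r` is.

It remains to see that strict pooling inequalities imply pooling. Being finitely many, strict and
continuous, they persist near `n`. They are Hall's condition for a routing that fills every capacity
(`exists_routing`, by separation of convex sets). Such a routing realises equal rates, which are the
only optimal ones by strict concavity (`isTheRateAllocation_const`). -/

/-- A supporting-line property of utility functions, strict away from the point of contact. -/
theorem IsUtility.exists_supporting_line {U : ℝ → EReal} (hU : IsUtility U) {x : ℝ} (hx : 0 < x) :
    ∃ d : ℝ, 0 ≤ d ∧ ∀ t, 0 ≤ t → t ≠ x → U t < (((U x).toReal + d * (t - x) : ℝ) : EReal) := by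
  set u : ℝ → ℝ := fun y => (U y).toReal with hu
  have hcoe : ∀ y, 0 < y → U y = (u y : EReal) := fun y hy =>
    (EReal.coe_toReal (hU.finite y hy).2 (hU.finite y hy).1).symm
  have hmono : ∀ a b, 0 < a → a < b → u a < u b := by
    intro a b ha hab
    have h := hU.strictMono (Set.mem_Ici.2 ha.le) (Set.mem_Ici.2 (ha.trans hab).le) hab
    rw [hcoe a ha, hcoe b (ha.trans hab)] at h
    exact_mod_cast h
  have hconc := hU.strictConcave
  have hdx : DifferentiableAt ℝ u x := (hU.differentiable x hx).differentiableAt (Ioi_mem_nhds hx)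
  have hpos : ∀ t, 0 < t → t ≠ x → u t < u x + deriv u x * (t - x) := by
    intro t ht htx
    rcases lt_or_gt_of_ne htx with h | h
    · have hs : deriv u x < slope u t x := hconc.deriv_lt_slope ht hx h hdx
      rw [slope_def_field, lt_div_iff₀ (by linarith)] at hs
      linarith
    · have hs : slope u x t < deriv u x := hconc.slope_lt_deriv hx ht h hdx
      rw [slope_def_field, div_lt_iff₀ (by linarith)] at hs
      linarith
  have hd : 0 ≤ deriv u x := by
    have h1 := hpos (x + 1) (by linarith) (by linarith)
    have h2 := hmono x (x + 1) hx (by linarith)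
    nlinarith
  refine ⟨deriv u x, hd, fun t ht htx => ?_⟩
  rcases ht.eq_or_lt with rfl | ht
  -- At `0` the value may be `⊥` and concavity is not given. The gap `δ` at `x / 2` persists along
  -- chords to all smaller `ε > 0`; a small `ε` absorbs `d * ε`, and monotonicity gives `U 0 < U ε`.
  · have hgap := hpos (x / 2) (by linarith) (by linarith)
    set δ := u x + deriv u x * (x / 2 - x) - u (x / 2) with hδ
    have hδ0 : 0 < δ := by linarith
    have hchord : ∀ ε, 0 < ε → ε < x / 2 → u ε ≤ u x + deriv u x * (ε - x) - δ := by
      intro ε hε hε2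
      have h := hconc.concaveOn.slope_anti_adjacent (x := ε) (y := x / 2) (z := x)
        hε hx hε2 (by linarith)
      rw [div_le_div_iff₀ (by linarith) (by linarith)] at h
      change (u x - u (x / 2)) * (x / 2 - ε) ≤ (u (x / 2) - u ε) * (x - x / 2) at h
      have h3 : u (x / 2) = u x + deriv u x * (x / 2 - x) - δ := by rw [hδ]; ring
      rw [h3] at h
      have h4 : 0 ≤ (u x + deriv u x * (ε - x) - δ - u ε) * (x / 2) := by
        nlinarith [mul_pos hδ0 (sub_pos.2 hε2)]
      linarith [nonneg_of_mul_nonneg_left h4 (by linarith)]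
    obtain ⟨ε, hε, hεx, hεd⟩ : ∃ ε, 0 < ε ∧ ε < x / 2 ∧ deriv u x * ε < δ := by
      refine ⟨min (x / 4) (δ / (2 * (deriv u x + 1))), by positivity, ?_, ?_⟩
      · exact (min_le_left _ _).trans_lt (by linarith)
      · have h1 : min (x / 4) (δ / (2 * (deriv u x + 1))) ≤ δ / (2 * (deriv u x + 1)) :=
          min_le_right _ _
        have h2 := mul_le_mul_of_nonneg_left h1 hd
        refine h2.trans_lt ?_
        rw [← mul_div_assoc, div_lt_iff₀ (by positivity)]
        nlinarith
    calc U 0 < U ε := hU.strictMono (Set.mem_Ici.2 le_rfl) (Set.mem_Ici.2 hε.le) hε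
      _ = (u ε : EReal) := hcoe ε hε
      _ ≤ _ := by
        have := hchord ε hε hεx
        exact_mod_cast (by linarith : u ε ≤ u x + deriv u x * (0 - x))
  · rw [hcoe t ht]
    exact_mod_cast hpos t ht htx

namespace Network

variable {I J : Type*}

/-! ### Supply and demand: routing under Hall's condition -/

section Transport

variable [Fintype I] [Fintype J] [DecidableEq I] [DecidableEq J]

theorem mem_compl_inside_compl {N : Network I J} {S : Finset J} {i : I} :
    i ∈ (N.inside Sᶜ)ᶜ ↔ ∃ j ∈ N.res i, j ∈ S := by
  simp [inside, Finset.subset_iff]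

/-- Hall-type inequalities for sets of resources imply their weighted version. -/
theorem sum_mul_le_of_forall_sum_le (N : Network I J) {m : I → ℝ} {c : J → ℝ}
    (hall : ∀ S : Finset J, ∑ j ∈ S, c j ≤ ∑ i ∈ (N.inside Sᶜ)ᶜ, m i)
    (g : I → J) (hg : ∀ i, g i ∈ N.res i) (p : J → ℝ) (hp : ∀ j, 0 ≤ p j)
    (hmax : ∀ i, ∀ j ∈ N.res i, p j ≤ p (g i)) :
    ∑ j, p j * c j ≤ ∑ i, m i * p (g i) := by
  -- Layer-cake argument: peel the least positive value `a` off the support `S` of `p`; Hall's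
  -- inequality for `S` handles this layer, and the remainder has smaller support.
  induction hk : (Finset.univ.filter fun j => 0 < p j).card using Nat.strong_induction_on
    generalizing p with
  | _ k ih =>
    set S := Finset.univ.filter fun j => 0 < p j with hS
    rcases S.eq_empty_or_nonempty with h0 | hne
    · have hz : ∀ j, p j = 0 := fun j => by
        have : j ∉ S := by simp [h0]
        simp only [hS, Finset.mem_filter, Finset.mem_univ, true_and, not_lt] at this
        exact le_antisymm this (hp j)
      simp [hz]
    · obtain ⟨j₀, hj₀, hmin⟩ := S.exists_min_image p hne
      have ha : 0 < p j₀ := by simpa [hS] using hj₀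
      set a := p j₀ with hadef
      have hsplit : ∀ j, p j = max (p j - a) 0 + if j ∈ S then a else 0 := by
        intro j
        by_cases hj : j ∈ S
        · rw [if_pos hj, max_eq_left (by linarith [hmin j hj])]; ring
        · have : p j = 0 := by
            simp only [hS, Finset.mem_filter, Finset.mem_univ, true_and, not_lt] at hj
            exact le_antisymm hj (hp j)
          rw [if_neg hj, this, max_eq_right (by linarith)]; simp
      -- Since `g i` maximizes `p` on `J(i)`, a type meets `S` exactly when its best resource lies
      -- in `S`.
      have htouch : ∀ i, g i ∈ S ↔ i ∈ (N.inside Sᶜ)ᶜ := by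
        intro i
        rw [mem_compl_inside_compl]
        refine ⟨fun h => ⟨g i, hg i, h⟩, fun ⟨j, hj, hjS⟩ => ?_⟩
        simp only [hS, Finset.mem_filter, Finset.mem_univ, true_and] at hjS ⊢
        exact hjS.trans_le (hmax i j hj)
      have hlt : (Finset.univ.filter fun j => 0 < max (p j - a) 0).card < k := by
        rw [← hk]
        apply Finset.card_lt_card
        rw [Finset.ssubset_iff_of_subset]
        · exact ⟨j₀, hj₀, by simp [hadef]⟩
        · intro j hj
          simp only [hS, Finset.mem_filter, Finset.mem_univ, true_and, lt_max_iff,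
            lt_irrefl, or_false] at hj ⊢
          linarith
      have hih := ih _ hlt (fun j => max (p j - a) 0) (fun j => le_max_right _ _)
        (fun i j hj => max_le_max (by linarith [hmax i j hj]) le_rfl) rfl
      have e1 : ∑ j, p j * c j = ∑ j, max (p j - a) 0 * c j + a * ∑ j ∈ S, c j := by
        rw [Finset.mul_sum, ← Fintype.sum_ite_mem S (fun j => a * c j),
          ← Finset.sum_add_distrib]
        refine Finset.sum_congr rfl fun j _ => ?_
        conv_lhs => rw [hsplit j]
        split_ifs <;> ring
      have e2 : ∑ i, m i * p (g i) = ∑ i, m i * max (p (g i) - a) 0 +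
          a * ∑ i ∈ (N.inside Sᶜ)ᶜ, m i := by
        rw [Finset.mul_sum, ← Fintype.sum_ite_mem (N.inside Sᶜ)ᶜ (fun i => a * m i),
          ← Finset.sum_add_distrib]
        refine Finset.sum_congr rfl fun i _ => ?_
        conv_lhs => rw [hsplit (g i)]
        simp only [htouch i]
        split_ifs <;> ring
      rw [e1, e2]
      exact add_le_add hih (mul_le_mul_of_nonneg_left (hall S) ha.le)

/-- Supply-demand theorem: the demand vector `m` can be routed so as to use every capacity
exactly if the total demand is the total capacity and Hall's condition holds. -/
theorem exists_routing (N : Network I J) {m : I → ℝ} {c : J → ℝ} (hm : ∀ i, 0 ≤ m i)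
    (htotal : ∑ i, m i = ∑ j, c j)
    (hall : ∀ S : Finset J, ∑ j ∈ S, c j ≤ ∑ i ∈ (N.inside Sᶜ)ᶜ, m i) :
    ∃ z : I → J → ℝ, (∀ i j, 0 ≤ z i j) ∧ (∀ i j, j ∉ N.res i → z i j = 0) ∧
      (∀ i, ∑ j, z i j = m i) ∧ ∀ j, ∑ i, z i j = c j := by
  set Z : Set (I → J → ℝ) := {z | (∀ i j, 0 ≤ z i j) ∧ (∀ i j, j ∉ N.res i → z i j = 0) ∧
    ∀ i, ∑ j, z i j = m i} with hZ
  let T : (I → J → ℝ) →ₗ[ℝ] (J → ℝ) :=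
    { toFun := fun z j => ∑ i, z i j
      map_add' := fun a b => by ext j; simp [Finset.sum_add_distrib]
      map_smul' := fun a b => by ext j; simp [Finset.mul_sum] }
  have hconv : Convex ℝ Z := by
    rintro z ⟨h1, h2, h3⟩ w ⟨k1, k2, k3⟩ a b ha hb hab
    refine ⟨fun i j => ?_, fun i j hj => ?_, fun i => ?_⟩
    · exact add_nonneg (mul_nonneg ha (h1 i j)) (mul_nonneg hb (k1 i j))
    · simp [h2 i j hj, k2 i j hj]
    · simp only [Pi.add_apply, Pi.smul_apply, smul_eq_mul, Finset.sum_add_distrib,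
        ← Finset.mul_sum, h3, k3, ← add_mul, hab, one_mul]
  have hclosed : IsClosed Z := by
    simp only [hZ, Set.ofPred_and, Set.ofPred_forall]
    refine IsClosed.inter ?_ (IsClosed.inter ?_ ?_)
    · exact isClosed_iInter fun i => isClosed_iInter fun j =>
        isClosed_le continuous_const (by fun_prop)
    · exact isClosed_iInter fun i => isClosed_iInter fun j => isClosed_iInter fun _ =>
        isClosed_eq (by fun_prop) continuous_const
    · exact isClosed_iInter fun i => isClosed_eq (by fun_prop) continuous_const
  have hcompact : IsCompact Z := by
    refine (isCompact_Icc (a := (0 : I → J → ℝ)) (b := fun i _ => m i)).of_isClosed_subset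
      hclosed ?_
    rintro z ⟨h1, -, h3⟩
    refine ⟨fun i j => h1 i j, fun i j => ?_⟩
    change z i j ≤ m i
    rw [← h3 i]
    exact Finset.single_le_sum (fun j _ => h1 i j) (Finset.mem_univ j)
  have hTcont : Continuous T := T.continuous_of_finiteDimensional
  have key : c ∈ T '' Z := by
    by_contra hc
    obtain ⟨f, u, hfu, huc⟩ := geometric_hahn_banach_closed_point (hconv.linear_image T)
      (hcompact.image hTcont).isClosed hc
    set q : J → ℝ := fun j => f (Pi.single j 1) with hq
    have hf : ∀ v : J → ℝ, f v = ∑ j, q j * v j := by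
      intro v
      conv_lhs => rw [← Finset.univ_sum_single v, map_sum]
      refine Finset.sum_congr rfl fun j _ => ?_
      rw [← mul_one (v j), ← smul_eq_mul, Pi.single_smul, map_smul, smul_eq_mul, smul_eq_mul, mul_one,
        mul_comm]
    -- The separating functional is largest on `Z` when each type sends all its demand to its best
    -- resource.
    choose g hg hmax using fun i => (N.res i).exists_max_image q (N.res_nonempty i)
    have hzmem : (fun i j => if j = g i then m i else 0) ∈ Z := by
      refine ⟨fun i j => ?_, fun i j hj => ?_, fun i => ?_⟩
      · dsimp only; split_ifs <;> simp [hm i]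
      · have : j ≠ g i := fun h => hj (h ▸ hg i)
        simp [this]
      · simp
    have h1 := hfu _ ⟨_, hzmem, rfl⟩
    have h2 : f (T fun i j => if j = g i then m i else 0) = ∑ i, m i * q (g i) := by
      rw [hf]
      change ∑ j, q j * ∑ i, (if j = g i then m i else 0) = _
      simp only [Finset.mul_sum]
      rw [Finset.sum_comm]
      simp [mul_comm]
    rw [h2] at h1
    rw [hf] at huc
    -- Shifting the prices to be nonnegative adds the same amount to both sides, because the totals
    -- of `m` and `c` agree.
    obtain ⟨b, hb⟩ : ∃ b : ℝ, ∀ j, 0 ≤ q j + b :=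
      ⟨∑ j, |q j|, fun j => by
        have := Finset.single_le_sum (f := fun j => |q j|) (fun j _ => abs_nonneg _)
          (Finset.mem_univ j)
        linarith [neg_abs_le (q j)]⟩
    have h3 := N.sum_mul_le_of_forall_sum_le hall g hg (fun j => q j + b) hb
      (fun i j hj => by linarith [hmax i j hj])
    simp only [add_mul, mul_add, Finset.sum_add_distrib, ← Finset.mul_sum, ← Finset.sum_mul,
      htotal] at h3
    linarith
  obtain ⟨z, ⟨h1, h2, h3⟩, hz⟩ := key
  exact ⟨z, h1, h2, h3, fun j => congrFun hz j⟩

end Transport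

/-! ### Optimality and uniqueness of equal rates -/

section Optimality

variable [Fintype I] [Fintype J]

/-- If all flows can be given the same rate `x` so that the capacity is exhausted, then `x` is
the unique optimal rate. -/
theorem isTheRateAllocation_const (N : Network I J) {U : ℝ → EReal} (hU : IsUtility U)
    {n : I → ℝ} (hn : ∀ i, 0 < n i) {x : ℝ} (hx : 0 < x)
    (htotal : ∑ i, n i * x = ∑ j, N.C j) {z : I → J → ℝ} (hz : ∀ i j, 0 ≤ z i j)
    (hsupp : ∀ i j, j ∉ N.res i → z i j = 0) (hrow : ∀ i, ∑ j, z i j = n i * x)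
    (hcol : ∀ j, ∑ i, z i j = N.C j) : N.IsTheRateAllocation U n fun _ => x := by
  obtain ⟨d, hd, hline⟩ := hU.exists_supporting_line hx
  set u := (U x).toReal with hu
  have hUx : U x = (u : EReal) := (EReal.coe_toReal (hU.finite x hx).2 (hU.finite x hx).1).symm
  set L : ℝ → ℝ := fun t => u + d * (t - x) with hL
  have hle : ∀ t, 0 ≤ t → U t ≤ (L t : EReal) := by
    intro t ht
    rcases eq_or_ne t x with rfl | h
    · simp [hUx, hL]
    · exact (hline t ht h).le
  set y : I → J → ℝ := fun i j => z i j / n i with hy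
  have hsum : ∀ i, ∑ j, y i j = x := fun i => by
    rw [← Finset.sum_div, hrow, mul_div_cancel_left₀ _ (hn i).ne']
  have hfeas : N.IsFeasible n y := by
    refine ⟨fun i j => div_nonneg (hz i j) (hn i).le, fun i j hj => by simp [hy, hsupp i j hj],
      fun j => ?_⟩
    rw [← hcol j]
    exact (Finset.sum_congr rfl fun i _ => mul_div_cancel₀ _ (hn i).ne').le
  have coe_sum : ∀ f : I → ℝ, ((∑ i, f i : ℝ) : EReal) = ∑ i, (f i : EReal) := fun f =>
    map_sum (⟨⟨(↑), EReal.coe_zero⟩, EReal.coe_add⟩ : ℝ →+ EReal) f Finset.univ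
  have hval : utility U n y = ((∑ i, n i * u : ℝ) : EReal) := by
    rw [coe_sum]
    simp only [utility, hsum, hUx, EReal.coe_mul]
  -- The linearised utility sees only the total rate, which is at most `C(J)`; since `d ≥ 0`, equal
  -- rates attain its maximum.
  have hbudget : ∀ y', N.IsFeasible n y' → ∑ i, n i * L (∑ j, y' i j) ≤ ∑ i, n i * u := by
    intro y' hy'
    have h1 : ∑ i, n i * ∑ j, y' i j ≤ ∑ i, n i * x := by
      rw [htotal]
      simp only [Finset.mul_sum]
      rw [Finset.sum_comm]
      exact Finset.sum_le_sum fun j _ => hy'.capacity j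
    have h2 : ∑ i, n i * L (∑ j, y' i j) = ∑ i, n i * u +
        d * (∑ i, n i * ∑ j, y' i j - ∑ i, n i * x) := by
      rw [← Finset.sum_sub_distrib, Finset.mul_sum, ← Finset.sum_add_distrib]
      exact Finset.sum_congr rfl fun i _ => by simp only [hL]; ring
    rw [h2]
    nlinarith
  have hnn : ∀ y', N.IsFeasible n y' → ∀ i, 0 ≤ ∑ j, y' i j := fun y' hy' i =>
    Finset.sum_nonneg fun j _ => hy'.nonneg i j
  have hterm : ∀ y', N.IsFeasible n y' → ∀ i,
      (n i : EReal) * U (∑ j, y' i j) ≤ ((n i * L (∑ j, y' i j) : ℝ) : EReal) := by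
    intro y' hy' i
    rw [EReal.coe_mul]
    exact mul_le_mul_of_nonneg_left (hle _ (hnn y' hy' i)) (by exact_mod_cast (hn i).le)
  have hopt : ∀ y', N.IsFeasible n y' → utility U n y' ≤ utility U n y := by
    intro y' hy'
    rw [hval]
    calc utility U n y' ≤ ∑ i, ((n i * L (∑ j, y' i j) : ℝ) : EReal) :=
          Finset.sum_le_sum fun i _ => hterm y' hy' i
      _ = ((∑ i, n i * L (∑ j, y' i j) : ℝ) : EReal) := (coe_sum _).symm
      _ ≤ _ := by exact_mod_cast hbudget y' hy'
  intro x'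
  constructor
  · rintro ⟨⟨y', hy', hopt', hx'⟩, -⟩
    funext i₀
    rw [hx' i₀ (hn i₀).ne']
    by_contra hne
    -- A real `e` inside the gap moves the strict comparison to real sums; in `EReal` other terms
    -- could be `⊥` and hide it.
    obtain ⟨e, he1, he2⟩ := EReal.lt_iff_exists_real_btwn.1 (hline _ (hnn y' hy' i₀) hne)
    have he2' : e < L (∑ j, y' i₀ j) := by exact_mod_cast he2
    classical
    have h1 : utility U n y' ≤
        ((∑ i, n i * (if i = i₀ then e else L (∑ j, y' i j)) : ℝ) : EReal) := by
      rw [coe_sum]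
      refine Finset.sum_le_sum fun i _ => ?_
      split_ifs with h
      · subst h
        rw [EReal.coe_mul]
        exact mul_le_mul_of_nonneg_left he1.le (by exact_mod_cast (hn i).le)
      · exact hterm y' hy' i
    have h2 : ∑ i, n i * (if i = i₀ then e else L (∑ j, y' i j)) <
        ∑ i, n i * L (∑ j, y' i j) := by
      refine Finset.sum_lt_sum (fun i _ => ?_) ⟨i₀, Finset.mem_univ _, ?_⟩
      · refine mul_le_mul_of_nonneg_left ?_ (hn i).le
        split_ifs with h
        · subst h; exact he2'.le
        · exact le_rfl
      · rw [if_pos rfl]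
        exact mul_lt_mul_of_pos_left he2' (hn i₀)
    have h3 := (hopt' y hfeas).trans h1
    rw [hval, EReal.coe_le_coe_iff] at h3
    exact absurd (h3.trans_lt (h2.trans_le (hbudget y' hy'))) (lt_irrefl _)
  · rintro rfl
    exact ⟨⟨y, hfeas, hopt, fun i _ => (hsum i).symm⟩, fun i hi => absurd hi (hn i).ne'⟩

/-- Without flow types there is only one rate vector, and it is optimal. -/
theorem isTheRateAllocation_of_isEmpty [IsEmpty I] (N : Network I J) (U : ℝ → EReal)
    (n x : I → ℝ) : N.IsTheRateAllocation U n x := by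
  intro x'
  refine ⟨fun _ => Subsingleton.elim _ _, fun _ => ⟨⟨fun _ _ => 0, ?_, ?_, ?_⟩, ?_⟩⟩
  · exact ⟨fun i => isEmptyElim i, fun i => isEmptyElim i, fun j => by simpa using (N.C_pos j).le⟩
  · intro y' _
    simp [utility]
  · exact fun i => isEmptyElim i
  · exact fun i => isEmptyElim i

end Optimality

/-! ### From connected sets to all sets of resources -/

section Connectivity

variable [Fintype I] [DecidableEq I] [DecidableEq J]

/-- The stability inequality extends from the strongly connected sets to all nonempty sets. -/
theorem Stable.sum_lt {N : Network I J} {rho : I → ℝ} (h : N.Stable rho) (S : Finset J)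
    (hS : S.Nonempty) : ∑ i ∈ N.inside S, rho i < ∑ j ∈ S, N.C j := by
  induction S using Finset.strongInduction with
  | H S ih =>
    by_cases hc : N.StronglyConnected S
    · exact h S hc
    · simp only [StronglyConnected, ConnectedPair, hS, true_and, not_not] at hc
      obtain ⟨J₁, J₂, h1, h2, hd, hu, I₁, I₂, -, hIu, hI1, hI2⟩ := hc
      have hdisj : Disjoint J₁ J₂ := Finset.disjoint_iff_inter_eq_empty.2 hd
      have hlt1 : J₁ ⊂ S := by
        rw [← hu, Finset.ssubset_iff_of_subset Finset.subset_union_left]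
        obtain ⟨j, hj⟩ := h2
        exact ⟨j, Finset.mem_union_right _ hj, Finset.disjoint_right.1 hdisj hj⟩
      have hlt2 : J₂ ⊂ S := by
        rw [← hu, Finset.ssubset_iff_of_subset Finset.subset_union_right]
        obtain ⟨j, hj⟩ := h1
        exact ⟨j, Finset.mem_union_left _ hj, Finset.disjoint_left.1 hdisj hj⟩
      -- No type confined to `S` straddles the split, so both sides of the inequality are additive.
      have hin : N.inside S = N.inside J₁ ∪ N.inside J₂ := by
        ext i
        simp only [Finset.mem_union]
        constructor
        · intro hi
          have hi' : N.res i ⊆ J₁ ∪ J₂ := by rw [hu]; simpa [inside] using hi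
          rw [← hIu, Finset.mem_union] at hi
          simp only [inside, Finset.mem_filter, Finset.mem_univ, true_and]
          rcases hi with hi | hi
          · have := Finset.disjoint_iff_inter_eq_empty.2 (hI1 i hi)
            exact Or.inl (this.left_le_of_le_sup_right hi')
          · have := Finset.disjoint_iff_inter_eq_empty.2 (hI2 i hi)
            exact Or.inr (this.left_le_of_le_sup_left hi')
        · simp only [inside, Finset.mem_filter, Finset.mem_univ, true_and]
          rintro (hi | hi)
          · exact hi.trans hlt1.1
          · exact hi.trans hlt2.1
      have hind : Disjoint (N.inside J₁) (N.inside J₂) := by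
        rw [Finset.disjoint_left]
        intro i hi1 hi2
        simp only [inside, Finset.mem_filter, Finset.mem_univ, true_and] at hi1 hi2
        obtain ⟨j, hj⟩ := N.res_nonempty i
        exact Finset.disjoint_left.1 hdisj (hi1 hj) (hi2 hj)
      rw [hin, Finset.sum_union hind, ← hu, Finset.sum_union hdisj]
      exact add_lt_add (ih J₁ hlt1 h1) (ih J₂ hlt2 h2)

/-- The pooling inequality extends from the connected proper sets to all nonempty proper sets. -/
theorem PoolingCondition.lt_sum [Fintype J] {N : Network I J} {rho : I → ℝ}
    (h : N.PoolingCondition rho) (S : Finset J) (hS : S.Nonempty) (hne : S ≠ Finset.univ) :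
    ∑ j ∈ S, N.C j < ∑ i ∈ (N.inside Sᶜ)ᶜ, rho i := by
  induction S using Finset.strongInduction with
  | H S ih =>
    by_cases hc : N.Connected S
    · exact h S hc hne
    · simp only [Connected, ConnectedPair, hS, true_and, not_not] at hc
      obtain ⟨J₁, J₂, h1, h2, hd, hu, I₁, I₂, -, hIu, hI1, hI2⟩ := hc
      have hdisj : Disjoint J₁ J₂ := Finset.disjoint_iff_inter_eq_empty.2 hd
      have hlt1 : J₁ ⊂ S := by
        rw [← hu, Finset.ssubset_iff_of_subset Finset.subset_union_left]
        obtain ⟨j, hj⟩ := h2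
        exact ⟨j, Finset.mem_union_right _ hj, Finset.disjoint_right.1 hdisj hj⟩
      have hlt2 : J₂ ⊂ S := by
        rw [← hu, Finset.ssubset_iff_of_subset Finset.subset_union_right]
        obtain ⟨j, hj⟩ := h1
        exact ⟨j, Finset.mem_union_left _ hj, Finset.disjoint_left.1 hdisj hj⟩
      have hin : (N.inside Sᶜ)ᶜ = (N.inside J₁ᶜ)ᶜ ∪ (N.inside J₂ᶜ)ᶜ := by
        ext i
        simp only [Finset.mem_union, mem_compl_inside_compl, ← hu]
        constructor
        · rintro ⟨j, hj, hj' | hj'⟩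
          exacts [Or.inl ⟨j, hj, hj'⟩, Or.inr ⟨j, hj, hj'⟩]
        · rintro (⟨j, hj, hj'⟩ | ⟨j, hj, hj'⟩)
          exacts [⟨j, hj, Or.inl hj'⟩, ⟨j, hj, Or.inr hj'⟩]
      have hind : Disjoint (N.inside J₁ᶜ)ᶜ (N.inside J₂ᶜ)ᶜ := by
        rw [Finset.disjoint_left]
        intro i hi1 hi2
        rw [mem_compl_inside_compl] at hi1 hi2
        obtain ⟨j, hj, hj'⟩ := hi1
        obtain ⟨k, hk, hk'⟩ := hi2
        have hi : i ∈ I₁ ∪ I₂ := hIu ▸ Finset.mem_univ i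
        rcases Finset.mem_union.1 hi with hi | hi
        · exact Finset.disjoint_left.1 (Finset.disjoint_iff_inter_eq_empty.2 (hI1 i hi)) hk hk'
        · exact Finset.disjoint_left.1 (Finset.disjoint_iff_inter_eq_empty.2 (hI2 i hi)) hj hj'
      have hne1 : J₁ ≠ Finset.univ := fun he => hlt1.2 (he ▸ Finset.subset_univ _)
      have hne2 : J₂ ≠ Finset.univ := fun he => hlt2.2 (he ▸ Finset.subset_univ _)
      rw [hin, Finset.sum_union hind, ← hu, Finset.sum_union hdisj]
      exact add_lt_add (ih J₁ hlt1 h1 hne1) (ih J₂ hlt2 h2 hne2)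

end Connectivity

/-! ### From strict inequalities to complete resource pooling -/

section Pooling

variable [Fintype I] [Fintype J] [DecidableEq I] [DecidableEq J]

/-- A positive state is in complete resource pooling if, with equal rates, the load of the types
that can use a proper nonempty set of resources exceeds the capacity of this set. -/
theorem isCompleteResourcePooling_of_lt [Nonempty I] (N : Network I J) {U : ℝ → EReal}
    (hU : IsUtility U) {n : I → ℝ} (hn : ∀ i, 0 < n i)
    (h : ∀ S : Finset J, S.Nonempty → S ≠ Finset.univ →
      ∑ j ∈ S, N.C j < ∑ i ∈ (N.inside Sᶜ)ᶜ, n i * ((∑ j, N.C j) / ∑ k, n k)) :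
    N.IsCompleteResourcePooling U n := by
  have hJ : (Finset.univ : Finset J).Nonempty :=
    let ⟨i⟩ := ‹Nonempty I›
    (N.res_nonempty i).mono (Finset.subset_univ _)
  have hC : 0 < ∑ j, N.C j := Finset.sum_pos (fun j _ => N.C_pos j) hJ
  have hsum : ∀ v : I → ℝ, (∀ i, 0 < v i) → 0 < ∑ i, v i := fun v hv =>
    Finset.sum_pos (fun i _ => hv i) Finset.univ_nonempty
  refine Filter.Eventually.filter_mono nhdsWithin_le_nhds ?_
  have e1 : ∀ᶠ v : I → ℝ in 𝓝 n, ∀ i, 0 < v i :=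
    Filter.eventually_all.2 fun i =>
      (continuous_apply i).continuousAt.eventually (lt_mem_nhds (hn i))
  have e2 : ∀ᶠ v : I → ℝ in 𝓝 n, ∀ S : Finset J, S.Nonempty → S ≠ Finset.univ →
      ∑ j ∈ S, N.C j < ∑ i ∈ (N.inside Sᶜ)ᶜ, v i * ((∑ j, N.C j) / ∑ k, v k) := by
    refine Filter.eventually_all.2 fun S => ?_
    by_cases hS : S.Nonempty ∧ S ≠ Finset.univ
    · have hcont : ContinuousAt
          (fun v : I → ℝ => ∑ i ∈ (N.inside Sᶜ)ᶜ, v i * ((∑ j, N.C j) / ∑ k, v k)) n := by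
        have := (hsum n hn).ne'
        refine tendsto_finsetSum _ fun i _ => (continuous_apply i).continuousAt.mul
          (continuousAt_const.div (Continuous.continuousAt (by fun_prop)) this)
      filter_upwards [hcont.eventually (lt_mem_nhds (h S hS.1 hS.2))] with v hv _ _ using hv
    · exact Filter.Eventually.of_forall fun v h1 h2 => absurd ⟨h1, h2⟩ hS
  filter_upwards [e1, e2] with v hv hpool
  have hv0 := hsum v hv
  set x := (∑ j, N.C j) / ∑ i, v i with hx
  have hx0 : 0 < x := div_pos hC hv0
  have htotal : ∑ i, v i * x = ∑ j, N.C j := by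
    rw [← Finset.sum_mul, hx, mul_div_cancel₀ _ hv0.ne']
  obtain ⟨z, h1, h2, h3, h4⟩ := N.exists_routing (m := fun i => v i * x) (c := N.C)
    (fun i => (mul_pos (hv i) hx0).le) htotal (by
      intro S
      -- Pooling covers proper nonempty sets; for the full set, Hall's condition is the equality of
      -- totals.
      rcases S.eq_empty_or_nonempty with rfl | hS
      · simpa using Finset.sum_nonneg fun i _ => (mul_pos (hv i) hx0).le
      · by_cases hu : S = Finset.univ
        · subst hu
          have : (N.inside (Finset.univ : Finset J)ᶜ)ᶜ = Finset.univ := by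
            ext i
            rw [mem_compl_inside_compl]
            obtain ⟨j, hj⟩ := N.res_nonempty i
            simpa using ⟨j, hj⟩
          rw [this, htotal]
        · exact (hpool S hS hu).le)
  exact N.isTheRateAllocation_const hU hv hx0 htotal h1 h2 h3 h4

end Pooling

end Network

/-! ### Construction of the equilibrium -/

theorem mainTheorem8 {I J : Type*} [Fintype I] [Fintype J] [DecidableEq I] [DecidableEq J]
    (N : Network I J) (U : ℝ → EReal) (hU : IsUtility U)
    (lam mu : I → ℝ) (hlam : ∀ i, 0 < lam i) (hmu : ∀ i, 0 < mu i)
    (hstable : N.Stable fun i => lam i / mu i)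
    (hpool : N.PoolingCondition fun i => lam i / mu i) :
    ∀ r : I → ℝ, (∀ i, 0 < r i) →
      ∃ n : I → ℝ, N.IsEquilibrium U lam mu r n ∧ N.IsCompleteResourcePooling U n := by
  intro r hr
  -- Without types the pooled rate divides by zero, but there is only one rate vector.
  rcases isEmpty_or_nonempty I with hI | hI
  · exact ⟨0, ⟨fun i => le_rfl, 0, N.isTheRateAllocation_of_isEmpty U _ _,
      fun i => isEmptyElim i⟩, Filter.Eventually.of_forall fun v =>
        N.isTheRateAllocation_of_isEmpty U _ _⟩
  set rho : I → ℝ := fun i => lam i / mu i with hrho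
  have hrho0 : ∀ i, 0 < rho i := fun i => div_pos (hlam i) (hmu i)
  have hJ : (Finset.univ : Finset J).Nonempty :=
    let ⟨i⟩ := hI
    (N.res_nonempty i).mono (Finset.subset_univ _)
  have hstab : ∑ i, rho i < ∑ j, N.C j := by
    have h := hstable.sum_lt Finset.univ hJ
    simpa [Network.inside] using h
  obtain ⟨x, hx, hxC⟩ : ∃ x, 0 < x ∧ ∑ i, rho i * max 1 (x / r i) = ∑ j, N.C j := by
    set F : ℝ → ℝ := fun x => ∑ i, rho i * max 1 (x / r i) with hF
    have hcont : Continuous F := by fun_prop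
    obtain ⟨i₀⟩ := id hI
    have hC : 0 < ∑ j, N.C j := Finset.sum_pos (fun j _ => N.C_pos j) hJ
    have hF0 : F 0 < ∑ j, N.C j := by simpa [hF] using hstab
    -- At `x = b` the term `rho i₀ * (x / r i₀)` alone equals `C(J)`.
    set b := (∑ j, N.C j) * r i₀ / rho i₀ with hb
    have hb0 : 0 < b := div_pos (mul_pos hC (hr i₀)) (hrho0 i₀)
    have hFb : ∑ j, N.C j ≤ F b := by
      have h1 : rho i₀ * max 1 (b / r i₀) ≤ F b :=
        Finset.single_le_sum (f := fun i => rho i * max 1 (b / r i))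
          (fun i _ => mul_nonneg (hrho0 i).le (zero_le_one.trans (le_max_left _ _)))
          (Finset.mem_univ i₀)
      refine le_trans ?_ h1
      refine le_trans (le_of_eq ?_) (mul_le_mul_of_nonneg_left (le_max_right _ _) (hrho0 i₀).le)
      have := (hr i₀).ne'
      have := (hrho0 i₀).ne'
      rw [hb]
      field_simp
    obtain ⟨x, hx, hxe⟩ := intermediate_value_Icc hb0.le hcont.continuousOn ⟨hF0.le, hFb⟩
    refine ⟨x, lt_of_le_of_ne hx.1 ?_, hxe⟩
    rintro rfl
    exact hF0.ne hxe
  set n : I → ℝ := fun i => rho i / min x (r i) with hndef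
  have hmin : ∀ i, 0 < min x (r i) := fun i => lt_min hx (hr i)
  have hn : ∀ i, 0 < n i := fun i => div_pos (hrho0 i) (hmin i)
  have hnx : ∀ i, n i * x = rho i * max 1 (x / r i) := by
    intro i
    have := (hr i).ne'
    rcases le_total x (r i) with h | h
    · rw [hndef]
      simp only [min_eq_left h, max_eq_left ((div_le_one (hr i)).2 h)]
      field_simp
    · rw [hndef]
      simp only [min_eq_right h, max_eq_right ((one_le_div (hr i)).2 h)]
      field_simp
  have hn0 : 0 < ∑ i, n i := Finset.sum_pos (fun i _ => hn i) Finset.univ_nonempty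
  have hxeq : (∑ j, N.C j) / ∑ i, n i = x := by
    rw [div_eq_iff hn0.ne', ← hxC, mul_comm, Finset.sum_mul]
    exact Finset.sum_congr rfl fun i _ => (hnx i).symm
  have hcrp : N.IsCompleteResourcePooling U n := by
    refine N.isCompleteResourcePooling_of_lt hU hn fun S hS hne => ?_
    refine (hpool.lt_sum S hS hne).trans_le (Finset.sum_le_sum fun i _ => ?_)
    rw [hxeq, hnx]
    exact le_mul_of_one_le_right (hrho0 i).le (le_max_left _ _)
  refine ⟨n, ⟨fun i => (hn i).le, fun _ => x, ?_, fun i => ?_⟩, hcrp⟩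
  · have h := hcrp.self_of_nhdsWithin (fun i => (hn i).le)
    rwa [hxeq] at h
  · have h1 := (hmin i).ne'
    have h2 := (hmu i).ne'
    simp only [hndef, hrho]
    field_simp
    ring
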